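/- Let $\mathbb{T}$ be the unit circle with normalized Lebesgue measure, $L^2=L^2(\mathbb{T})$, and let $H^2\subset L^2$ be the Hardy space. For an inner function $\theta$ put $K^2_\theta=H^2\ominus\theta H^2$, let $P_\theta\colon L^2\to K^2_\theta$ be the orthogonal projection, and let $C_\theta$ be the conjugation on $K^2_\theta$ given by $(C_\theta f)(z)=\theta(z)\overline{z f(z)}$ for $|z|=1$. Write $L(\mathcal{H})$ for the bounded linear operators on a Hilbert space $\mathcal{H}$; an operator $A\in L(K^2_\theta)$ is called $C_\theta$-symmetric if $C_\theta A C_\theta=A^*$. Let $\mathcal{T}(\theta)$ be the set of bounded truncated Toeplitz operators on $K^2_\theta$, i.e. of those $A\in L(K^2_\theta)$ for which there is a symbol $\varphi\in L^2$ such that the operator $f\mapsto P_\theta(\varphi f)$, with dense domain $\{f\in K^2_\theta:\varphi f\in L^2\}$, agrees with $A$ on that domain. An inner function $\alpha$ divides $\theta$ if $\bar\alpha\theta$ is inner; then $K^2_\alpha\subset K^2_\theta$. **Theorem.** Let $$B(z)=e^{i\gamma}\prod_{j=1}^{N}\frac{z-a_j}{1-\bar a_j z},\qquad \gamma\in\mathbb{R},$$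 be a finite Blaschke product of degree $N$ with distinct zeros $a_1,\dots,a_N$ in the open unit disk, and for $n=1,\dots,N$ let $B_n(z)=\prod_{j=1}^{n}\frac{z-a_j}{1-\bar a_j z}$. Let $A\in L(K^2_B)$. The following conditions are equivalent: 1. $A\in\mathcal{T}(B)$; 2. for every (nonconstant, finite) Blaschke product $B_\sigma$ dividing $B$, the compression $A_\sigma=P_{B_\sigma}A_{|K^2_{B_\sigma}}$ is $C_{B_\sigma}$-symmetric; 3. for every $n=1,\dots,N$, the compression $A_n=P_{B_n}A_{|K^2_{B_n}}$ is $C_{B_n}$-symmetric. -/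

import Mathlib

open MeasureTheory AddCircle
open scoped ComplexConjugate InnerProductSpace

/-! The unit circle is parametrized by the angle, `x ↦ toCircle x = e^{ix}`, and carries its
normalized Lebesgue measure `haarAddCircle`. -/

/-- The unit circle `𝕋`. -/
abbrev UnitTorus : Type := AddCircle (2 * Real.pi)

instance instFactTwoPiPos : Fact (0 < 2 * Real.pi) := ⟨Real.two_pi_pos⟩

/-- The normalized Lebesgue measure `m` on `𝕋`. -/
noncomputable abbrev torusMeasure : Measure UnitTorus := haarAddCircle

/-- The Hilbert space `L²(𝕋, m)`. -/
abbrev L2Torus : Type := Lp ℂ 2 torusMeasure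

/-- An inner function, given by its boundary values: a measurable function on `𝕋`, unimodular
almost everywhere, whose Fourier coefficients of negative index vanish. -/
structure IsInner (θ : UnitTorus → ℂ) : Prop where
  aestronglyMeasurable : AEStronglyMeasurable θ torusMeasure
  norm_eq_one : ∀ᵐ x ∂torusMeasure, ‖θ x‖ = 1
  coeff_neg : ∀ n : ℤ, n < 0 → fourierCoeff θ n = 0

theorem fourierCoeff_eq_inner_fourierLp (f : L2Torus) (n : ℤ) :
    fourierCoeff (f : UnitTorus → ℂ) n = ⟪(fourierLp 2 n : L2Torus), f⟫_ℂ := by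
  rw [← fourierBasis_repr, HilbertBasis.repr_apply_apply, coe_fourierBasis]

/-- The Hardy space `H²`, as a subspace of `L²`. -/
noncomputable def hardySpace : Submodule ℂ L2Torus where
  carrier := {f | ∀ n : ℤ, n < 0 → fourierCoeff (f : UnitTorus → ℂ) n = 0}
  add_mem' {f g} hf hg n hn := by
    have h1 := hf n hn
    have h2 := hg n hn
    rw [fourierCoeff_eq_inner_fourierLp] at h1 h2 ⊢
    rw [inner_add_right, h1, h2, add_zero]
  zero_mem' n _ := by rw [fourierCoeff_eq_inner_fourierLp, inner_zero_right]
  smul_mem' c f hf n hn := by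
    have h1 := hf n hn
    rw [fourierCoeff_eq_inner_fourierLp] at h1 ⊢
    rw [inner_smul_right, h1, mul_zero]

/-- The set `θ H²`. -/
def innerMulHardy (θ : UnitTorus → ℂ) : Set L2Torus :=
  {h | ∃ g ∈ hardySpace, h =ᵐ[torusMeasure] fun x => θ x * g x}

/-- The model space `K²_θ = H² ⊖ θ H²`. -/
noncomputable def modelSpace (θ : UnitTorus → ℂ) : Submodule ℂ L2Torus :=
  hardySpace ⊓ (Submodule.span ℂ (innerMulHardy θ))ᗮ

theorem isClosed_hardySpace : IsClosed (hardySpace : Set L2Torus) := by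
  have : (hardySpace : Set L2Torus) =
      ⋂ n : ℤ, ⋂ _ : n < 0, {f : L2Torus | ⟪(fourierLp 2 n : L2Torus), f⟫_ℂ = 0} := by
    ext f
    simp only [Set.mem_iInter, Set.mem_ofPred_eq, ← fourierCoeff_eq_inner_fourierLp]
    rfl
  rw [this]
  exact isClosed_iInter fun n => isClosed_iInter fun _ =>
    isClosed_eq (continuous_const.inner continuous_id) continuous_const

instance instCompleteSpaceModelSpace (θ : UnitTorus → ℂ) : CompleteSpace (modelSpace θ) := by
  have h : IsClosed (modelSpace θ : Set L2Torus) :=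
    isClosed_hardySpace.inter (Submodule.isClosed_orthogonal _)
  exact h.completeSpace_coe

/-- The domain of the truncated Toeplitz operator with symbol `φ`. -/
def truncatedToeplitzDomain (θ : UnitTorus → ℂ) (φ : L2Torus) : Set (modelSpace θ) :=
  {f | MemLp (fun x => φ x * (f : L2Torus) x) 2 torusMeasure}

/-- `A ∈ 𝒯(θ)`: the bounded operator `A` on `K²_θ` is a truncated Toeplitz operator, that is, for
some symbol `φ ∈ L²` the densely defined operator `f ↦ P_θ (φ f)` agrees with `A` on its domain. -/
def IsTruncatedToeplitz (θ : UnitTorus → ℂ) (A : modelSpace θ →L[ℂ] modelSpace θ) : Prop :=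
  ∃ φ : L2Torus, Dense (truncatedToeplitzDomain θ φ) ∧
    ∀ (f : modelSpace θ) (hf : f ∈ truncatedToeplitzDomain θ φ),
      A f = (modelSpace θ).orthogonalProjectionOnto (MemLp.toLp _ hf)

/-- `A` is `C`-symmetric: `C A C = A*`. -/
def IsCSymmetric {H : Type*} [NormedAddCommGroup H] [InnerProductSpace ℂ H] [CompleteSpace H]
    (C : H →ₗ⋆[ℂ] H) (A : H →L[ℂ] H) : Prop :=
  ∀ f : H, C (A (C f)) = ContinuousLinearMap.adjoint A f

theorem inner_toLp_toLp {f g : UnitTorus → ℂ} (hf : MemLp f 2 torusMeasure)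
    (hg : MemLp g 2 torusMeasure) :
    ⟪(hf.toLp f : L2Torus), hg.toLp g⟫_ℂ = ∫ x, conj (f x) * g x ∂torusMeasure := by
  rw [L2.inner_def]
  refine integral_congr_ae ?_
  filter_upwards [hf.coeFn_toLp, hg.coeFn_toLp] with x h1 h2
  rw [h1, h2, RCLike.inner_apply, mul_comm]

theorem fourierCoeff_eq_integral_mul (f : UnitTorus → ℂ) (n : ℤ) :
    fourierCoeff f n = ∫ x, fourier (-n) x * f x ∂torusMeasure := by
  simp [fourierCoeff]

/-- The product of two functions with nonnegative spectrum has nonnegative spectrum. -/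
theorem fourierCoeff_mul_eq_zero {f g : UnitTorus → ℂ} (hf : MemLp f 2 torusMeasure)
    (hg : MemLp g 2 torusMeasure) (hf0 : ∀ n : ℤ, n < 0 → fourierCoeff f n = 0)
    (hg0 : ∀ n : ℤ, n < 0 → fourierCoeff g n = 0) (n : ℤ) (hn : n < 0) :
    fourierCoeff (fun x => f x * g x) n = 0 := by
  have hu : MemLp (fun x => fourier n x * conj (f x)) 2 torusMeasure := by
    refine hf.of_le ((by fun_prop : Continuous fun x : UnitTorus => fourier n x)
      |>.aestronglyMeasurable.mul (hf.1.star)) (Filter.Eventually.of_forall fun x => ?_)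
    rw [norm_mul, RCLike.norm_conj, fourier_apply, Circle.norm_coe, one_mul]
  have h1 : fourierCoeff (fun x => f x * g x) n = ⟪(hu.toLp _ : L2Torus), hg.toLp g⟫_ℂ := by
    rw [inner_toLp_toLp, fourierCoeff_eq_integral_mul]
    refine integral_congr_ae (Filter.Eventually.of_forall fun x => ?_)
    simp only [map_mul, Complex.conj_conj, fourier_neg, mul_assoc]
  rw [h1, ← (fourierBasis (T := 2 * Real.pi)).tsum_inner_mul_inner]
  refine (tsum_congr fun k => ?_).trans tsum_zero
  rw [coe_fourierBasis]
  rcases lt_or_ge k 0 with hk | hk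
  · have : ⟪(fourierLp 2 k : L2Torus), hg.toLp g⟫_ℂ = 0 := by
      rw [← fourierCoeff_eq_inner_fourierLp, fourierCoeff_congr_ae hg.coeFn_toLp]
      exact hg0 k hk
    rw [this, mul_zero]
  · have : ⟪(hu.toLp _ : L2Torus), (fourierLp 2 k : L2Torus)⟫_ℂ = 0 := by
      rw [L2.inner_def, ← hf0 (n - k) (by omega), fourierCoeff_eq_integral_mul]
      refine integral_congr_ae ?_
      filter_upwards [hu.coeFn_toLp, coeFn_fourierLp (T := 2 * Real.pi) 2 k] with x h2 h3
      rw [h2, h3, RCLike.inner_apply, neg_sub, sub_eq_add_neg, fourier_add, fourier_neg]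
      simp only [map_mul, Complex.conj_conj]
      ring
    rw [this, zero_mul]

theorem IsInner.memLp {θ : UnitTorus → ℂ} (hθ : IsInner θ) : MemLp θ 2 torusMeasure :=
  MemLp.of_bound hθ.aestronglyMeasurable 1 (hθ.norm_eq_one.mono fun _ h => h.le)

theorem IsInner.memLp_mul {θ f : UnitTorus → ℂ} (hθ : IsInner θ) (hf : MemLp f 2 torusMeasure) :
    MemLp (fun x => θ x * f x) 2 torusMeasure := by
  refine hf.of_le (hθ.aestronglyMeasurable.mul hf.1) ?_
  filter_upwards [hθ.norm_eq_one] with x hx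
  simp [hx]

theorem IsInner.mul {θ η : UnitTorus → ℂ} (hθ : IsInner θ) (hη : IsInner η) :
    IsInner (fun x => θ x * η x) where
  aestronglyMeasurable := hθ.aestronglyMeasurable.mul hη.aestronglyMeasurable
  norm_eq_one := by
    filter_upwards [hθ.norm_eq_one, hη.norm_eq_one] with x h1 h2
    simp [h1, h2]
  coeff_neg := fourierCoeff_mul_eq_zero hθ.memLp hη.memLp hθ.coeff_neg hη.coeff_neg

theorem IsInner.memLp_conj {θ : UnitTorus → ℂ} (hθ : IsInner θ) (f : L2Torus) :
    MemLp (fun x => θ x * conj ((toCircle x : ℂ) * f x)) 2 torusMeasure := by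
  refine hθ.memLp_mul ((Lp.memLp f).of_le ?_ (Filter.Eventually.of_forall fun x => ?_))
  · exact ((by fun_prop : Continuous fun x : UnitTorus => (fourier 1 x : ℂ)).aestronglyMeasurable.congr
      (Filter.Eventually.of_forall fun x => by simp [fourier_apply])
      |>.mul (Lp.aestronglyMeasurable f)).star
  · rw [RCLike.norm_conj, norm_mul, Circle.norm_coe, one_mul]

theorem mem_modelSpace_iff {θ : UnitTorus → ℂ} (hθ : IsInner θ) (f : L2Torus) :
    f ∈ modelSpace θ ↔ f ∈ hardySpace ∧
      ∀ g ∈ hardySpace, ∫ x, conj (θ x * g x) * f x ∂torusMeasure = 0 := by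
  have key : ∀ h g : L2Torus, (h =ᵐ[torusMeasure] fun x => θ x * g x) →
      ⟪h, f⟫_ℂ = ∫ x, conj (θ x * g x) * f x ∂torusMeasure := fun h g hh => by
    rw [L2.inner_def]
    refine integral_congr_ae ?_
    filter_upwards [hh] with x hx
    rw [hx, RCLike.inner_apply, mul_comm]
  refine and_congr_right fun _ => ⟨fun H g hg => ?_, fun H => ?_⟩
  · have hm := hθ.memLp_mul (Lp.memLp g)
    rw [← key _ g hm.coeFn_toLp]
    exact H _ (Submodule.subset_span ⟨g, hg, hm.coeFn_toLp⟩)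
  · refine (Submodule.mem_orthogonal _ _).2 fun u hu => ?_
    induction hu using Submodule.span_induction with
    | mem u hu =>
      obtain ⟨g, hg, hu⟩ := hu
      rw [key u g hu, H g hg]
    | zero => exact inner_zero_left _
    | add u v _ _ h1 h2 => rw [inner_add_left, h1, h2, add_zero]
    | smul c u _ h1 => rw [inner_smul_left, h1, mul_zero]

theorem fourierLp_mem_hardySpace (k : ℤ) (hk : 0 ≤ k) : (fourierLp 2 k : L2Torus) ∈ hardySpace := by
  intro n hn
  rw [fourierCoeff_eq_inner_fourierLp]
  exact orthonormal_fourier.2 (by omega)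

theorem IsInner.conj_mem_modelSpace {θ : UnitTorus → ℂ} (hθ : IsInner θ) {f : L2Torus}
    (hf : f ∈ modelSpace θ) : (hθ.memLp_conj f).toLp _ ∈ modelSpace θ := by
  rw [mem_modelSpace_iff hθ] at hf ⊢
  refine ⟨fun n hn => ?_, fun g hg => ?_⟩
  · rw [fourierCoeff_congr_ae (hθ.memLp_conj f).coeFn_toLp, fourierCoeff_eq_integral_mul]
    have h1 := congrArg conj (hf.2 _ (fourierLp_mem_hardySpace (-n - 1) (by omega)))
    rw [← integral_conj, map_zero] at h1
    rw [← h1]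
    refine integral_congr_ae ?_
    filter_upwards [coeFn_fourierLp (T := 2 * Real.pi) 2 (-n - 1)] with x hx
    rw [hx, sub_eq_add_neg, fourier_add, fourier_neg (n := 1), fourier_one]
    simp only [map_mul, Complex.conj_conj]
    ring
  · have h1 := congrArg conj (fourierCoeff_mul_eq_zero (Lp.memLp g) (Lp.memLp f) hg hf.1 (-1)
      (by norm_num))
    rw [fourierCoeff_eq_integral_mul, ← integral_conj, map_zero] at h1
    rw [← h1]
    refine integral_congr_ae ?_
    filter_upwards [(hθ.memLp_conj f).coeFn_toLp, hθ.norm_eq_one] with x hx h2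
    have h3 : conj (θ x) * θ x = 1 := by rw [Complex.conj_mul', h2]; simp
    rw [hx, neg_neg, fourier_one]
    simp only [map_mul]
    linear_combination (conj (g x) * conj (toCircle x : ℂ) * conj (f x)) * h3

/-- The conjugation `C_θ` on the model space `K²_θ`: `(C_θ f)(z) = θ(z) conj (z f(z))` on `𝕋`. -/
noncomputable def modelConj (θ : UnitTorus → ℂ) (hθ : IsInner θ) :
    modelSpace θ →ₗ⋆[ℂ] modelSpace θ where
  toFun f := ⟨(hθ.memLp_conj (f : L2Torus)).toLp _, hθ.conj_mem_modelSpace f.2⟩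
  map_add' f g := by
    refine Subtype.ext (Eq.trans ?_ (MemLp.toLp_add (hθ.memLp_conj f) (hθ.memLp_conj g)))
    refine MemLp.toLp_congr (hθ.memLp_conj _) _ ?_
    filter_upwards [Lp.coeFn_add (f : L2Torus) (g : L2Torus)] with x hx
    simp only [Submodule.coe_add, hx, Pi.add_apply, mul_add, map_add]
  map_smul' c f := by
    refine Subtype.ext (Eq.trans ?_ (MemLp.toLp_const_smul (conj c) (hθ.memLp_conj f)))
    refine MemLp.toLp_congr (hθ.memLp_conj _) _ ?_
    filter_upwards [Lp.coeFn_smul c (f : L2Torus)] with x hx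
    simp only [Submodule.coe_smul, hx, Pi.smul_apply, smul_eq_mul, map_mul]
    ring

/-- `α` divides `θ`: the quotient `conj α * θ` is an inner function. -/
def InnerDivides (α θ : UnitTorus → ℂ) : Prop := IsInner fun x => conj (α x) * θ x

theorem modelSpace_le_of_innerDivides {α θ : UnitTorus → ℂ} (hα : IsInner α)
    (h : InnerDivides α θ) : modelSpace α ≤ modelSpace θ := by
  refine inf_le_inf le_rfl (Submodule.orthogonal_le (Submodule.span_mono ?_))
  rintro u ⟨g, hg, hu⟩
  have hm := h.memLp_mul (Lp.memLp g)
  refine ⟨hm.toLp _, fun n hn => ?_, ?_⟩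
  · rw [fourierCoeff_congr_ae hm.coeFn_toLp]
    exact fourierCoeff_mul_eq_zero h.memLp (Lp.memLp g) h.coeff_neg hg n hn
  · filter_upwards [hu, hm.coeFn_toLp, hα.norm_eq_one] with x h1 h2 h3
    have h4 : conj (α x) * α x = 1 := by rw [Complex.conj_mul', h3]; simp
    rw [h1, h2]
    linear_combination (-(θ x * g x)) * h4

/-- The compression `P_α A|_{K²_α}` of an operator `A` on `K²_θ` to the subspace `K²_α`, where
`α` divides `θ`. -/
noncomputable def compression (α θ : UnitTorus → ℂ) (hα : IsInner α) (h : InnerDivides α θ)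
    (A : modelSpace θ →L[ℂ] modelSpace θ) : modelSpace α →L[ℂ] modelSpace α :=
  (modelSpace α).orthogonalProjectionOnto ∘L (modelSpace θ).subtypeL ∘L A ∘L
    ((modelSpace α).subtypeL.codRestrict (modelSpace θ)
      fun f => modelSpace_le_of_innerDivides hα h f.2)

open Complex.UnitDisc

/-- The finite Blaschke product `c ∏ⱼ (z - aⱼ) / (1 - conj aⱼ z)` with zeros `a₁, …, aₘ` in the
open unit disk and unimodular constant `c`. -/
noncomputable def blaschke {m : ℕ} (c : Circle) (a : Fin m → 𝔻) (z : ℂ) : ℂ :=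
  c * ∏ j, (z - (a j : ℂ)) / (1 - conj (a j : ℂ) * z)

/-- The restriction of a function to the unit circle. -/
noncomputable def onTorus (F : ℂ → ℂ) (x : UnitTorus) : ℂ := F (toCircle x)

/-- The first `n` of the points `a₁, …, a_N`. -/
def initialZeros {N : ℕ} (a : Fin N → 𝔻) {n : ℕ} (hn : n ≤ N) : Fin n → 𝔻 :=
  fun j => a (Fin.castLE hn j)

theorem one_sub_conj_mul_ne_zero (a : 𝔻) (x : UnitTorus) :
    1 - conj (a : ℂ) * (toCircle x : ℂ) ≠ 0 := by
  intro h
  have h1 : ‖conj (a : ℂ) * (toCircle x : ℂ)‖ = 1 := by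
    rw [← sub_eq_zero.1 h, norm_one]
  rw [norm_mul, Circle.norm_coe, mul_one, RCLike.norm_conj] at h1
  exact a.norm_lt_one.ne h1

theorem isInner_const (c : Circle) : IsInner fun _ => (c : ℂ) where
  aestronglyMeasurable := aestronglyMeasurable_const
  norm_eq_one := Filter.Eventually.of_forall fun _ => c.norm_coe
  coeff_neg n hn := by
    have h : fourierCoeff (fun _ : UnitTorus => (c : ℂ)) n
        = c * ⟪(fourierLp 2 n : L2Torus), (fourierLp 2 0 : L2Torus)⟫_ℂ := by
      rw [← fourierCoeff_eq_inner_fourierLp, ← fourierCoeff.const_mul]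
      refine congrFun (fourierCoeff_congr_ae ?_) n
      filter_upwards [coeFn_fourierLp (T := 2 * Real.pi) 2 0] with x hx
      rw [hx, fourier_zero, mul_one]
    rw [h, orthonormal_fourier.2 (by omega : n ≠ 0), mul_zero]

theorem continuous_toCircle_coe : Continuous fun x : UnitTorus => (toCircle x : ℂ) := by
  have : (fun x : UnitTorus => (toCircle x : ℂ)) = fun x => fourier 1 x := by
    ext x; exact fourier_one.symm
  rw [this]
  fun_prop

theorem isInner_blaschkeFactor (a : 𝔻) :
    IsInner fun x => ((toCircle x : ℂ) - (a : ℂ)) / (1 - conj (a : ℂ) * (toCircle x : ℂ)) := by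
  set b : UnitTorus → ℂ :=
    fun x => ((toCircle x : ℂ) - (a : ℂ)) / (1 - conj (a : ℂ) * (toCircle x : ℂ)) with hb
  have hcont : Continuous b :=
    (continuous_toCircle_coe.sub continuous_const).div
      (continuous_const.sub (continuous_const.mul continuous_toCircle_coe))
      (one_sub_conj_mul_ne_zero a)
  have hnorm : ∀ x, ‖b x‖ = 1 := by
    intro x
    have hz : conj (toCircle x : ℂ) * (toCircle x : ℂ) = 1 := by
      rw [Complex.conj_mul', Circle.norm_coe]; simp
    have h1 : (toCircle x : ℂ) - (a : ℂ)
        = (toCircle x : ℂ) * conj (1 - conj (a : ℂ) * (toCircle x : ℂ)) := by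
      simp only [map_sub, map_mul, map_one, Complex.conj_conj]
      linear_combination (a : ℂ) * hz
    have h2 : ‖1 - conj (a : ℂ) * (toCircle x : ℂ)‖ ≠ 0 :=
      norm_ne_zero_iff.2 (one_sub_conj_mul_ne_zero a x)
    rw [hb]
    simp only
    rw [norm_div, h1, norm_mul, RCLike.norm_conj, Circle.norm_coe, one_mul, div_self h2]
  have hint : ∀ g : UnitTorus → ℂ, Continuous g → Integrable g torusMeasure := fun g hg =>
    hg.integrable_of_hasCompactSupport (HasCompactSupport.of_compactSpace g)
  refine ⟨hcont.aestronglyMeasurable, Filter.Eventually.of_forall hnorm, ?_⟩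
  have hbound : ∀ n, ‖fourierCoeff b n‖ ≤ 1 := fun n => by
    rw [fourierCoeff_eq_integral_mul]
    refine (norm_integral_le_of_norm_le_const (C := 1)
      (Filter.Eventually.of_forall fun x => ?_)).trans (by simp)
    rw [norm_mul, hnorm, fourier_apply, Circle.norm_coe, one_mul]
  have hmon : ∀ n k : ℤ, n ≠ k → fourierCoeff (fun x : UnitTorus => fourier k x) n = 0 := by
    intro n k h
    rw [← (orthonormal_fourier (T := 2 * Real.pi)).2 h, ← fourierCoeff_eq_inner_fourierLp]
    exact (congrFun (fourierCoeff_congr_ae (coeFn_fourierLp (T := 2 * Real.pi) 2 k)) n).symm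
  have hrec : ∀ n : ℤ, n < 0 → fourierCoeff b n = conj (a : ℂ) * fourierCoeff b (n - 1) := by
    intro n hn
    have e1 := hmon n 1 (by omega)
    have e0 := hmon n 0 (by omega)
    simp only [fourierCoeff_eq_integral_mul] at e1 e0 ⊢
    rw [← sub_eq_zero, ← integral_const_mul, ← integral_sub]
    · have : ∀ x : UnitTorus, fourier (-n) x * b x - conj (a : ℂ) * (fourier (-(n - 1)) x * b x)
          = fourier (-n) x * fourier 1 x - (a : ℂ) * (fourier (-n) x * fourier 0 x) := by
        intro x
        rw [show -(n - 1) = -n + 1 by ring, fourier_add, fourier_one, fourier_zero]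
        have h1 : b x * (1 - conj (a : ℂ) * (toCircle x : ℂ)) = (toCircle x : ℂ) - (a : ℂ) :=
          div_mul_cancel₀ _ (one_sub_conj_mul_ne_zero a x)
        linear_combination (fourier (-n) x : ℂ) * h1
      simp only [this]
      rw [integral_sub, integral_const_mul, e1, e0]
      · simp
      · exact hint _ (by fun_prop)
      · exact hint _ (by fun_prop)
    · exact hint _ (by fun_prop)
    · exact hint _ (by fun_prop)
  have hiter : ∀ (k : ℕ) (n : ℤ), n < 0 → ‖fourierCoeff b n‖ ≤ ‖(a : ℂ)‖ ^ k := by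
    intro k
    induction k with
    | zero => intro n _; simpa using hbound n
    | succ k ih =>
      intro n hn
      rw [hrec n hn, norm_mul, RCLike.norm_conj, pow_succ']
      exact mul_le_mul_of_nonneg_left (ih _ (by omega)) (norm_nonneg _)
  intro n hn
  have h0 := tendsto_pow_atTop_nhds_zero_of_lt_one (norm_nonneg (a : ℂ)) a.norm_lt_one
  exact norm_le_zero_iff.1 (ge_of_tendsto' h0 fun k => hiter k n hn)

theorem isInner_prod_blaschkeFactor {m : ℕ} (a : Fin m → 𝔻) :
    IsInner fun x => ∏ j,
      ((toCircle x : ℂ) - (a j : ℂ)) / (1 - conj (a j : ℂ) * (toCircle x : ℂ)) := by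
  induction m with
  | zero => simpa using isInner_const 1
  | succ m ih =>
    simp only [Fin.prod_univ_succ]
    exact (isInner_blaschkeFactor (a 0)).mul (ih fun j => a j.succ)

theorem isInner_blaschke {m : ℕ} (c : Circle) (a : Fin m → 𝔻) : IsInner (onTorus (blaschke c a)) :=
  (isInner_const c).mul (isInner_prod_blaschkeFactor a)

theorem innerDivides_blaschke_initialZeros {N : ℕ} (c : Circle) (a : Fin N → 𝔻) {n : ℕ}
    (hn : n ≤ N) :
    InnerDivides (onTorus (blaschke 1 (initialZeros a hn))) (onTorus (blaschke c a)) := by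
  obtain ⟨k, rfl⟩ := Nat.exists_eq_add_of_le hn
  have h := isInner_blaschke c fun j : Fin k => a (Fin.natAdd n j)
  have h1 := (isInner_blaschke 1 (initialZeros a hn)).norm_eq_one
  have heq : onTorus (blaschke c fun j : Fin k => a (Fin.natAdd n j)) =ᵐ[torusMeasure]
      fun x => conj (onTorus (blaschke 1 (initialZeros a hn)) x) * onTorus (blaschke c a) x := by
    filter_upwards [h1] with x hx
    have h3 : conj (onTorus (blaschke 1 (initialZeros a hn)) x) *
        onTorus (blaschke 1 (initialZeros a hn)) x = 1 := by
      rw [Complex.conj_mul', hx]; simp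
    have h4 : onTorus (blaschke c a) x = onTorus (blaschke 1 (initialZeros a hn)) x *
        onTorus (blaschke c fun j : Fin k => a (Fin.natAdd n j)) x := by
      simp only [onTorus, blaschke, Fin.prod_univ_add, initialZeros, Circle.coe_one]
      have : ∀ j : Fin n, Fin.castLE hn j = Fin.castAdd k j := fun _ => rfl
      simp only [this]
      ring
    rw [h4, ← mul_assoc, h3, one_mul]
  exact ⟨h.aestronglyMeasurable.congr heq,
    by filter_upwards [heq, h.norm_eq_one] with x e1 e2; rw [← e1, e2],
    fun n hn => by rw [← fourierCoeff_congr_ae heq]; exact h.coeff_neg n hn⟩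

/-! Add the zeros of the Blaschke product one at a time. If `K²_{α b_a} = K²_α ⊕ ℂ e` with
`e = α k_a`, let `A` be a `C`-symmetric operator on `K²_{α b_a}` whose compression to `K²_α` is the
truncated Toeplitz operator with bounded symbol `φ`. Then `D = A - A_φ` is `C`-symmetric and has
zero compression to `e^⊥ = K²_α`, so it consists of a row and a column along `e`, and symmetry
forces `D = s e ⊗ C e + t C e ⊗ e`. Since `C e = k_a` reproduces the value at `a`, the operators
`e ⊗ C e` and `C e ⊗ e` are truncated Toeplitz, with symbols `α k_a` and its conjugate; hence so
is `A`. -/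

/-- The Hardy class `H^p`, as a predicate on functions rather than on classes in `L^p`. -/
structure MemHardy (f : UnitTorus → ℂ) (p : ENNReal) : Prop where
  memLp : MemLp f p torusMeasure
  coeff_neg : ∀ n : ℤ, n < 0 → fourierCoeff f n = 0

theorem memHardy_coe_iff {f : L2Torus} : MemHardy f 2 ↔ f ∈ hardySpace :=
  ⟨MemHardy.coeff_neg, fun hf => ⟨Lp.memLp f, hf⟩⟩

theorem IsInner.memHardy {θ : UnitTorus → ℂ} (hθ : IsInner θ) (p : ENNReal) : MemHardy θ p :=
  ⟨MemLp.of_bound hθ.aestronglyMeasurable 1 (hθ.norm_eq_one.mono fun _ h => h.le), hθ.coeff_neg⟩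

theorem IsInner.conj_mul_self {θ : UnitTorus → ℂ} (hθ : IsInner θ) :
    ∀ᵐ x ∂torusMeasure, conj (θ x) * θ x = 1 := by
  filter_upwards [hθ.norm_eq_one] with x hx
  rw [Complex.conj_mul', hx, Complex.ofReal_one, one_pow]

namespace MemHardy

variable {f g u : UnitTorus → ℂ} {p : ENNReal}

theorem toLp_mem_hardySpace (hf : MemHardy f 2) : hf.memLp.toLp f ∈ hardySpace := fun n hn => by
  rw [fourierCoeff_congr_ae hf.memLp.coeFn_toLp, hf.coeff_neg n hn]

theorem const_mul (hf : MemHardy f p) (c : ℂ) : MemHardy (fun x => c * f x) p where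
  memLp := hf.memLp.const_mul c
  coeff_neg n hn := by rw [fourierCoeff.const_mul, hf.coeff_neg n hn, mul_zero]

theorem const (c : ℂ) (p : ENNReal) : MemHardy (fun _ => c) p := by
  simpa using ((isInner_const 1).memHardy p).const_mul c

theorem add (hp : 1 ≤ p) (hf : MemHardy f p) (hg : MemHardy g p) :
    MemHardy (fun x => f x + g x) p where
  memLp := hf.memLp.add hg.memLp
  coeff_neg n hn := by
    have h := congrFun (fourierCoeff.add (hf.memLp.integrable hp) (hg.memLp.integrable hp)) n
    rw [Pi.add_apply, hf.coeff_neg n hn, hg.coeff_neg n hn, add_zero] at h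
    exact h

theorem mul (hp : 2 ≤ p) (hu : MemHardy u ⊤) (hf : MemHardy f p) :
    MemHardy (fun x => u x * f x) p where
  memLp := hf.memLp.mul hu.memLp
  coeff_neg := fourierCoeff_mul_eq_zero (hu.memLp.mono_exponent le_top)
    (hf.memLp.mono_exponent hp) hu.coeff_neg hf.coeff_neg

end MemHardy

theorem fourierCoeff_toCircle_mul (f : UnitTorus → ℂ) (n : ℤ) :
    fourierCoeff (fun x => (toCircle x : ℂ) * f x) n = fourierCoeff f (n - 1) := by
  simp only [fourierCoeff_eq_integral_mul, sub_eq_neg_add, neg_add_rev, neg_neg,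
    fourier_add, fourier_one, mul_assoc]

theorem memHardy_toCircle (p : ENNReal) : MemHardy (fun x => (toCircle x : ℂ)) p := by
  simpa using (isInner_blaschkeFactor 0).memHardy p

theorem conj_toCircle_mul_self (x : UnitTorus) : conj (toCircle x : ℂ) * (toCircle x : ℂ) = 1 := by
  rw [Complex.conj_mul', Circle.norm_coe, Complex.ofReal_one, one_pow]

/-- The Szegő kernel `k_a(z) = 1 / (1 - conj a z)`, which reproduces the value at `a` on `H²`. -/
noncomputable def szegoKernel (a : 𝔻) (x : UnitTorus) : ℂ :=
  (1 - conj (a : ℂ) * (toCircle x : ℂ))⁻¹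

/-- The Blaschke factor `b_a(z) = (z - a) / (1 - conj a z)`. -/
noncomputable def blaschkeFactor (a : 𝔻) (x : UnitTorus) : ℂ :=
  ((toCircle x : ℂ) - (a : ℂ)) / (1 - conj (a : ℂ) * (toCircle x : ℂ))

theorem szegoKernel_mul (a : 𝔻) (x : UnitTorus) :
    szegoKernel a x * (1 - conj (a : ℂ) * (toCircle x : ℂ)) = 1 :=
  inv_mul_cancel₀ (one_sub_conj_mul_ne_zero a x)

theorem conj_toCircle_mul_szegoKernel (a : 𝔻) (x : UnitTorus) :
    conj ((toCircle x : ℂ) * szegoKernel a x) * ((toCircle x : ℂ) - (a : ℂ)) = 1 := by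
  have h := congrArg conj (szegoKernel_mul a x)
  simp only [map_mul, map_sub, map_one, Complex.conj_conj] at h ⊢
  linear_combination h + conj (szegoKernel a x) * conj_toCircle_mul_self x

theorem blaschkeFactor_mul_conj (a : 𝔻) (x : UnitTorus) :
    blaschkeFactor a x * conj ((toCircle x : ℂ) * szegoKernel a x) = szegoKernel a x := by
  rw [blaschkeFactor, div_eq_mul_inv, ← szegoKernel]
  linear_combination szegoKernel a x * conj_toCircle_mul_szegoKernel a x

theorem memHardy_szegoKernel (a : 𝔻) (p : ENNReal) (hp : 1 ≤ p) : MemHardy (szegoKernel a) p := by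
  have ha : 1 - conj (a : ℂ) * a ≠ 0 := by
    rw [Complex.conj_mul', ← Complex.ofReal_pow, sub_ne_zero, ne_comm, ← Complex.ofReal_one,
      Ne, Complex.ofReal_inj]
    exact (pow_lt_one₀ (norm_nonneg _) a.norm_lt_one two_ne_zero).ne
  have h := ((MemHardy.const 1 p).add hp
    (((isInner_blaschkeFactor a).memHardy p).const_mul (conj a))).const_mul (1 - conj (a : ℂ) * a)⁻¹
  convert h using 2 with x
  rw [eq_inv_mul_iff_mul_eq₀ ha, div_eq_mul_inv, ← szegoKernel]
  linear_combination szegoKernel_mul a x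

theorem integral_conj_szegoKernel (a : 𝔻) : ∫ x, conj (szegoKernel a x) ∂torusMeasure = 1 := by
  have hk := memHardy_szegoKernel a 2 one_le_two
  have hzk : fourierCoeff (fun x => (toCircle x : ℂ) * szegoKernel a x) 0 = 0 := by
    rw [fourierCoeff_toCircle_mul, hk.coeff_neg _ (by norm_num)]
  have hint : Integrable (fun x => (toCircle x : ℂ) * szegoKernel a x) torusMeasure :=
    ((memHardy_toCircle ⊤).mul le_rfl hk).memLp.integrable one_le_two
  have heq : ∀ x, szegoKernel a x = 1 + conj (a : ℂ) * ((toCircle x : ℂ) * szegoKernel a x) :=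
    fun x => by linear_combination szegoKernel_mul a x
  simp only [fourierCoeff_eq_integral_mul, neg_zero, fourier_zero, one_mul] at hzk
  rw [integral_conj, integral_congr_ae (.of_forall heq),
    integral_add (integrable_const 1) (hint.const_mul _), integral_const_mul, hzk]
  simp

/-- The functional `g ↦ ∫ conj k_a · g`, the value at `a` of `g ∈ H²`. -/
noncomputable def diskEval (a : 𝔻) (g : UnitTorus → ℂ) : ℂ :=
  ∫ x, conj (szegoKernel a x) * g x ∂torusMeasure

/-- The divided difference `(g(z) - g(a)) / (z - a)`; on the circle `1 / (z - a)` is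
`conj (z k_a(z))`. -/
noncomputable def dividedDifference (a : 𝔻) (g : UnitTorus → ℂ) (x : UnitTorus) : ℂ :=
  conj ((toCircle x : ℂ) * szegoKernel a x) * (g x - diskEval a g)

theorem szegoKernel_mul_eq_add (a : 𝔻) (g : UnitTorus → ℂ) (x : UnitTorus) :
    szegoKernel a x * g x =
      diskEval a g * szegoKernel a x + blaschkeFactor a x * dividedDifference a g x := by
  rw [dividedDifference]
  linear_combination (diskEval a g - g x) * blaschkeFactor_mul_conj a x

theorem fourierCoeff_dividedDifference_neg_one (a : 𝔻) {g : UnitTorus → ℂ} (hg : MemHardy g 2) :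
    fourierCoeff (dividedDifference a g) (-1) = 0 := by
  have hk : MemLp (fun x => conj (szegoKernel a x)) 2 torusMeasure :=
    (memHardy_szegoKernel a 2 one_le_two).memLp.star
  have hkg : Integrable (fun x => conj (szegoKernel a x) * g x) torusMeasure :=
    hk.integrable_mul hg.memLp
  have heq : ∀ x, fourier (-(-1)) x * dividedDifference a g x =
      conj (szegoKernel a x) * g x - diskEval a g * conj (szegoKernel a x) := fun x => by
    rw [neg_neg, fourier_one, dividedDifference, map_mul]
    linear_combination conj (szegoKernel a x) * (g x - diskEval a g) * conj_toCircle_mul_self x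
  rw [fourierCoeff_eq_integral_mul, integral_congr_ae (.of_forall heq),
    integral_sub hkg ((hk.integrable one_le_two).const_mul _),
    integral_const_mul, integral_conj_szegoKernel, mul_one, ← diskEval, sub_self]

theorem memHardy_of_toCircle_sub_mul {p : ENNReal} (hp : 1 ≤ p) (c : ℂ) {h : UnitTorus → ℂ}
    (hh : MemLp h p torusMeasure) (hmul : MemHardy (fun x => ((toCircle x : ℂ) - c) * h x) p)
    (hneg : fourierCoeff h (-1) = 0) : MemHardy h p := by
  have hzh : MemLp (fun x => (toCircle x : ℂ) * h x) p torusMeasure :=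
    hh.mul (memHardy_toCircle ⊤).memLp
  have hstep : ∀ n : ℤ, n < 0 → fourierCoeff h (n - 1) = c * fourierCoeff h n := fun n hn => by
    have h0 := hmul.coeff_neg n hn
    have hadd := congrFun (fourierCoeff.add (hzh.integrable hp)
      ((hh.const_mul (-c)).integrable hp)) n
    have heq : (fun x => ((toCircle x : ℂ) - c) * h x) =
        (fun x => (toCircle x : ℂ) * h x) + fun x => -c * h x := by
      ext x; simp only [Pi.add_apply]; ring
    rw [Pi.add_apply, fourierCoeff_toCircle_mul, fourierCoeff.const_mul, ← heq, h0] at hadd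
    linear_combination -hadd
  refine ⟨hh, fun n hn => ?_⟩
  induction n, (show n ≤ -1 by omega) using Int.leInductionDown with
  | base => exact hneg
  | pred n hn' ih => rw [hstep n (by omega), ih (by omega), mul_zero]

theorem memHardy_dividedDifference (a : 𝔻) {g : UnitTorus → ℂ} (hg : MemHardy g 2) :
    MemHardy (dividedDifference a g) 2 := by
  have hzk := ((memHardy_toCircle ⊤).mul le_top (memHardy_szegoKernel a ⊤ le_top)).memLp.star
  have hgc : MemHardy (fun x => g x + -diskEval a g) 2 := hg.add one_le_two (.const _ 2)
  have hmul : (fun x => ((toCircle x : ℂ) - a) * dividedDifference a g x) =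
      fun x => g x + -diskEval a g := by
    ext x
    rw [dividedDifference]
    linear_combination (g x - diskEval a g) * conj_toCircle_mul_szegoKernel a x
  exact memHardy_of_toCircle_sub_mul one_le_two a (hgc.memLp.mul hzk) (hmul ▸ hgc)
    (fourierCoeff_dividedDifference_neg_one a hg)

theorem MemHardy.exists_eq_const_mul_szegoKernel_add (a : 𝔻) {g : UnitTorus → ℂ}
    (hg : MemHardy g 2) : ∃ (c : ℂ) (h : UnitTorus → ℂ), MemHardy h 2 ∧
      ∀ x, g x = c * szegoKernel a x + blaschkeFactor a x * h x := by
  have hu : MemHardy (fun x => (1 + -conj (a : ℂ) * toCircle x) * g x) 2 :=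
    (MemHardy.add le_top (.const 1 ⊤) ((memHardy_toCircle ⊤).const_mul _)).mul le_rfl hg
  refine ⟨_, dividedDifference a _, memHardy_dividedDifference a hu, fun x =>
    Eq.trans ?_ (szegoKernel_mul_eq_add a _ x)⟩
  linear_combination -g x * szegoKernel_mul a x

theorem inner_eq_integral_conj_mul (f g : L2Torus) :
    ⟪f, g⟫_ℂ = ∫ x, conj (f x) * g x ∂torusMeasure := by
  simp only [L2.inner_def, RCLike.inner_apply, mul_comm]

section ModelSpace

variable {θ α : UnitTorus → ℂ}

theorem inner_eq_zero_of_mem_modelSpace {f u : L2Torus} (hf : f ∈ modelSpace θ)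
    {h : UnitTorus → ℂ} (hh : MemHardy h 2) (hu : u =ᵐ[torusMeasure] fun x => θ x * h x) :
    ⟪f, u⟫_ℂ = 0 := by
  refine inner_eq_zero_symm.1 (hf.2 u (Submodule.subset_span
    ⟨hh.memLp.toLp h, hh.toLp_mem_hardySpace, ?_⟩))
  filter_upwards [hu, hh.memLp.coeFn_toLp] with x hux hhx
  rw [hux, hhx]

theorem modelSpace_eq_bot_of_ae_eq_const (hα : IsInner α) {c : ℂ}
    (h : ∀ᵐ x ∂torusMeasure, α x = c) : modelSpace α = ⊥ := by
  refine (Submodule.eq_bot_iff _).2 fun f hf => (inner_self_eq_zero (𝕜 := ℂ)).1 ?_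
  refine inner_eq_zero_of_mem_modelSpace hf ((memHardy_coe_iff.2 hf.1).const_mul (conj c)) ?_
  filter_upwards [h, hα.conj_mul_self] with x hx hx1
  rw [hx] at hx1 ⊢
  linear_combination -f x * hx1

theorem modelSpace_le_of_eq_const_mul {c : ℂ} (h : ∀ x, θ x = c * α x) :
    modelSpace α ≤ modelSpace θ := by
  refine inf_le_inf_left _ (Submodule.orthogonal_le (Submodule.span_mono ?_))
  rintro u ⟨g, hg, hu⟩
  refine ⟨c • g, hardySpace.smul_mem c hg, ?_⟩
  filter_upwards [hu, Lp.coeFn_smul c g] with x hux hcg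
  rw [hux, hcg, h, Pi.smul_apply, smul_eq_mul]
  ring

end ModelSpace

section Conjugation

variable {H : Type*} [NormedAddCommGroup H] [InnerProductSpace ℂ H]

/-- A conjugation on `H`: an antilinear isometric involution. The isometry property is stated in
polarized form. -/
structure IsConjugation (C : H →ₗ⋆[ℂ] H) : Prop where
  inner_comm : ∀ f g, ⟪C f, g⟫_ℂ = ⟪C g, f⟫_ℂ
  apply_apply : ∀ f, C (C f) = f

theorem exists_eq_smul_of_forall_inner_eq_zero {e x : H}
    (h : ∀ f : H, ⟪e, f⟫_ℂ = 0 → ⟪f, x⟫_ℂ = 0) : ∃ c : ℂ, x = c • e := by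
  have hx : x ∈ (ℂ ∙ e)ᗮᗮ := fun f hf =>
    h f (Submodule.mem_orthogonal_singleton_iff_inner_right.1 hf)
  rw [Submodule.orthogonal_orthogonal] at hx
  obtain ⟨c, hc⟩ := Submodule.mem_span_singleton.1 hx
  exact ⟨c, hc.symm⟩

theorem inner_sub_inner_div_smul (e f : H) : ⟪e, f - (⟪e, f⟫_ℂ / ⟪e, e⟫_ℂ) • e⟫_ℂ = 0 := by
  rw [inner_sub_right, inner_smul_right, div_mul_cancel_of_imp, sub_self]
  intro h
  rw [inner_self_eq_zero.1 h, inner_zero_left]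

variable [CompleteSpace H] {C : H →ₗ⋆[ℂ] H} {A D : H →L[ℂ] H} {e : H}

theorem IsConjugation.isCSymmetric_iff (hC : IsConjugation C) :
    IsCSymmetric C A ↔ ∀ f g, ⟪C f, A g⟫_ℂ = ⟪C g, A f⟫_ℂ := by
  refine ⟨fun h f g => ?_, fun h f => ext_inner_right ℂ fun g => ?_⟩
  · rw [hC.inner_comm g, ← ContinuousLinearMap.adjoint_inner_left, ← h (C f), hC.apply_apply]
  · rw [ContinuousLinearMap.adjoint_inner_left, hC.inner_comm, h, hC.apply_apply]

theorem IsCSymmetric.sub (hA : IsCSymmetric C A) (hD : IsCSymmetric C D) :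
    IsCSymmetric C (A - D) := fun f => by
  simp only [sub_apply, map_sub, hA f, hD f]

theorem IsCSymmetric.const_smul (hA : IsCSymmetric C A) (c : ℂ) : IsCSymmetric C (c • A) :=
  fun f => by
    simp only [smul_apply, map_smulₛₗ, hA f]

open InnerProductSpace (rankOne)

theorem IsConjugation.isCSymmetric_rankOne (hC : IsConjugation C) (e : H) :
    IsCSymmetric C (rankOne ℂ e (C e)) := by
  refine hC.isCSymmetric_iff.2 fun f g => ?_
  simp only [InnerProductSpace.rankOne_apply, inner_smul_right, hC.inner_comm e, mul_comm]

theorem IsConjugation.exists_apply_eq_smul_of_inner_eq_zero (hC : IsConjugation C)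
    (hD : IsCSymmetric C D) (hzero : ∀ f g, ⟪e, f⟫_ℂ = 0 → ⟪e, g⟫_ℂ = 0 → ⟪f, D g⟫_ℂ = 0)
    {f₀ : H} (hf₀ : ⟪e, f₀⟫_ℂ = 0) (hne : ⟪C e, f₀⟫_ℂ ≠ 0) :
    ∃ s : ℂ, ∀ g, ⟪e, g⟫_ℂ = 0 → D g = s • rankOne ℂ e (C e) g := by
  obtain ⟨l₀, hl₀⟩ := exists_eq_smul_of_forall_inner_eq_zero fun f hf => hzero f f₀ hf hf₀
  refine ⟨l₀ / ⟪C e, f₀⟫_ℂ, fun g hg => ?_⟩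
  obtain ⟨l, hl⟩ := exists_eq_smul_of_forall_inner_eq_zero fun f hf => hzero f g hf hg
  have hsymm : l * ⟪C e, f₀⟫_ℂ = l₀ * ⟪C e, g⟫_ℂ := by
    have h := hC.isCSymmetric_iff.1 hD f₀ g
    rwa [hl, hl₀, inner_smul_right, inner_smul_right, hC.inner_comm f₀, hC.inner_comm g] at h
  rw [hl, InnerProductSpace.rankOne_apply, smul_smul, div_mul_eq_mul_div, ← hsymm,
    mul_div_cancel_right₀ _ hne]

theorem IsConjugation.exists_eq_smul_rankOne_of_apply_eq_zero (hC : IsConjugation C)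
    (hD : IsCSymmetric C D) (hzero : ∀ g, ⟪e, g⟫_ℂ = 0 → D g = 0) :
    ∃ t : ℂ, D = t • rankOne ℂ (C e) e := by
  obtain ⟨c, hc⟩ : ∃ c : ℂ, C (D e) = c • e :=
    exists_eq_smul_of_forall_inner_eq_zero fun g hg => by
      rw [inner_eq_zero_symm, hC.inner_comm, hC.isCSymmetric_iff.1 hD, hzero g hg, inner_zero_right]
  have hDe : D e = conj c • C e := by rw [← LinearMap.map_smulₛₗ, ← hc, hC.apply_apply]
  refine ⟨conj c / ⟪e, e⟫_ℂ, ContinuousLinearMap.ext fun f => ?_⟩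
  have hf := hzero _ (inner_sub_inner_div_smul e f)
  rw [map_sub, map_smul, hDe, sub_eq_zero] at hf
  rw [hf, smul_apply, InnerProductSpace.rankOne_apply, smul_smul, smul_smul]
  ring_nf

/-- `D` vanishes between vectors of `e^⊥`, so in the decomposition `H = ℂ e ⊕ e^⊥` only its first
row and column survive; `C`-symmetry determines each of them up to a scalar. -/
theorem IsConjugation.exists_eq_smul_rankOne_add (hC : IsConjugation C) (hD : IsCSymmetric C D)
    (hzero : ∀ f g, ⟪e, f⟫_ℂ = 0 → ⟪e, g⟫_ℂ = 0 → ⟪f, D g⟫_ℂ = 0)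
    (he : (∃ f, ⟪e, f⟫_ℂ = 0 ∧ ⟪C e, f⟫_ℂ ≠ 0) ∨ ∀ f, ⟪e, f⟫_ℂ = 0 → f = 0) :
    ∃ s t : ℂ, D = s • rankOne ℂ e (C e) + t • rankOne ℂ (C e) e := by
  obtain ⟨s, hs⟩ : ∃ s : ℂ, ∀ g, ⟪e, g⟫_ℂ = 0 → D g = s • rankOne ℂ e (C e) g := by
    rcases he with ⟨f₀, hf₀, hne⟩ | hbot
    · exact hC.exists_apply_eq_smul_of_inner_eq_zero hD hzero hf₀ hne
    · exact ⟨0, fun g hg => by rw [hbot g hg, map_zero, map_zero, smul_zero]⟩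
  obtain ⟨t, ht⟩ := hC.exists_eq_smul_rankOne_of_apply_eq_zero (e := e)
    (hD.sub ((hC.isCSymmetric_rankOne e).const_smul s)) fun g hg => by
      rw [sub_apply, hs g hg, smul_apply, sub_self]
  exact ⟨s, t, by rw [← ht, add_sub_cancel]⟩

end Conjugation

section ModelConj

variable {θ α : UnitTorus → ℂ}

theorem coeFn_modelConj (hθ : IsInner θ) (f : modelSpace θ) :
    (modelConj θ hθ f : L2Torus) =ᵐ[torusMeasure]
      fun x => θ x * conj ((toCircle x : ℂ) * (f : L2Torus) x) :=
  (hθ.memLp_conj (f : L2Torus)).coeFn_toLp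

theorem isConjugation_modelConj (hθ : IsInner θ) : IsConjugation (modelConj θ hθ) where
  inner_comm f g := by
    rw [Submodule.coe_inner, Submodule.coe_inner, inner_eq_integral_conj_mul,
      inner_eq_integral_conj_mul]
    refine integral_congr_ae ?_
    filter_upwards [coeFn_modelConj hθ f, coeFn_modelConj hθ g] with x hf hg
    simp only [hf, hg, map_mul, Complex.conj_conj]
    ring
  apply_apply f := by
    refine Subtype.ext (Lp.ext ?_)
    filter_upwards [coeFn_modelConj hθ f, coeFn_modelConj hθ (modelConj θ hθ f),
      hθ.conj_mul_self] with x hf hCf hx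
    simp only [hCf, hf, map_mul, Complex.conj_conj]
    linear_combination ((f : L2Torus) x * conj (toCircle x : ℂ) * toCircle x) * hx
      + (f : L2Torus) x * conj_toCircle_mul_self x

theorem isCSymmetric_modelConj_of_inner_eq_integral (hθ : IsInner θ)
    {A : modelSpace θ →L[ℂ] modelSpace θ} {φ : UnitTorus → ℂ}
    (hA : ∀ f g : modelSpace θ, ⟪f, A g⟫_ℂ =
      ∫ x, conj ((f : L2Torus) x) * (φ x * (g : L2Torus) x) ∂torusMeasure) :
    IsCSymmetric (modelConj θ hθ) A := by
  refine (isConjugation_modelConj hθ).isCSymmetric_iff.2 fun f g => ?_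
  rw [hA, hA]
  refine integral_congr_ae ?_
  filter_upwards [coeFn_modelConj hθ f, coeFn_modelConj hθ g] with x hf hg
  simp only [hf, hg, map_mul, Complex.conj_conj]
  ring

theorem inner_compression (hα : IsInner α) (h : InnerDivides α θ)
    (A : modelSpace θ →L[ℂ] modelSpace θ) (f g : modelSpace α) :
    ⟪f, compression α θ hα h A g⟫_ℂ =
      ⟪(f : L2Torus), (A ⟨g, modelSpace_le_of_innerDivides hα h g.2⟩ : L2Torus)⟫_ℂ :=
  (modelSpace α).inner_orthogonalProjectionOnto_eq_of_mem_left f _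

end ModelConj

section TruncatedToeplitz

variable {θ : UnitTorus → ℂ}

/-- The truncated Toeplitz operator `f ↦ P_θ (φ f)` on `K²_θ` with a bounded symbol `φ`. -/
noncomputable def truncatedToeplitz (θ : UnitTorus → ℂ) (φ : Lp ℂ ⊤ torusMeasure) :
    modelSpace θ →L[ℂ] modelSpace θ :=
  (modelSpace θ).orthogonalProjectionOnto ∘L
    (ContinuousLinearMap.mul ℂ ℂ).holderL torusMeasure ⊤ 2 2 φ ∘L (modelSpace θ).subtypeL

theorem truncatedToeplitz_add (φ ψ : Lp ℂ ⊤ torusMeasure) :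
    truncatedToeplitz θ (φ + ψ) = truncatedToeplitz θ φ + truncatedToeplitz θ ψ := by
  simp only [truncatedToeplitz, map_add, ContinuousLinearMap.add_comp, ContinuousLinearMap.comp_add]

theorem truncatedToeplitz_smul (c : ℂ) (φ : Lp ℂ ⊤ torusMeasure) :
    truncatedToeplitz θ (c • φ) = c • truncatedToeplitz θ φ := by
  simp only [truncatedToeplitz, map_smul, ContinuousLinearMap.smul_comp,
    ContinuousLinearMap.comp_smul]

theorem inner_truncatedToeplitz (φ : Lp ℂ ⊤ torusMeasure) (f g : modelSpace θ) {u : L2Torus}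
    (hu : u =ᵐ[torusMeasure] fun x => φ x * (g : L2Torus) x) :
    ⟪f, truncatedToeplitz θ φ g⟫_ℂ = ⟪(f : L2Torus), u⟫_ℂ := by
  rw [Lp.ext (hu.trans ((ContinuousLinearMap.mul ℂ ℂ).coeFn_holder φ (g : L2Torus)).symm)]
  exact (modelSpace θ).inner_orthogonalProjectionOnto_eq_of_mem_left f _

theorem inner_truncatedToeplitz_eq_integral (φ : Lp ℂ ⊤ torusMeasure) (f g : modelSpace θ) :
    ⟪f, truncatedToeplitz θ φ g⟫_ℂ =
      ∫ x, conj ((f : L2Torus) x) * (φ x * (g : L2Torus) x) ∂torusMeasure := by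
  have hφg := (ContinuousLinearMap.mul ℂ ℂ).coeFn_holder (r := 2) φ (g : L2Torus)
  rw [inner_truncatedToeplitz φ f g hφg, inner_eq_integral_conj_mul]
  refine integral_congr_ae ?_
  filter_upwards [hφg] with x hx
  rw [hx, ContinuousLinearMap.mul_apply']

theorem truncatedToeplitz_star (φ : Lp ℂ ⊤ torusMeasure) :
    truncatedToeplitz θ (star φ) = ContinuousLinearMap.adjoint (truncatedToeplitz θ φ) := by
  refine ContinuousLinearMap.ext fun g => ext_inner_left ℂ fun f => ?_
  rw [ContinuousLinearMap.adjoint_inner_right, ← inner_conj_symm (truncatedToeplitz θ φ f) g,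
    inner_truncatedToeplitz_eq_integral, inner_truncatedToeplitz_eq_integral, ← integral_conj]
  refine integral_congr_ae ?_
  filter_upwards [Lp.coeFn_star φ] with x hx
  rw [hx, Pi.star_apply, RCLike.star_def]
  simp only [map_mul, Complex.conj_conj]
  ring

theorem isCSymmetric_truncatedToeplitz (hθ : IsInner θ) (φ : Lp ℂ ⊤ torusMeasure) :
    IsCSymmetric (modelConj θ hθ) (truncatedToeplitz θ φ) :=
  isCSymmetric_modelConj_of_inner_eq_integral hθ (inner_truncatedToeplitz_eq_integral φ)

theorem isTruncatedToeplitz_truncatedToeplitz (φ : Lp ℂ ⊤ torusMeasure) :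
    IsTruncatedToeplitz θ (truncatedToeplitz θ φ) := by
  have hφ : MemLp φ 2 torusMeasure := (Lp.memLp φ).mono_exponent le_top
  have hmul : ∀ f : modelSpace θ, (fun x => φ x * (f : L2Torus) x) =ᵐ[torusMeasure]
      fun x => hφ.toLp φ x * (f : L2Torus) x := fun f => by
    filter_upwards [hφ.coeFn_toLp] with x hx
    rw [hx]
  have hdom : truncatedToeplitzDomain θ (hφ.toLp φ) = Set.univ :=
    Set.eq_univ_of_forall fun f => MemLp.ae_eq (hmul f) ((Lp.memLp _).mul (Lp.memLp φ))
  refine ⟨hφ.toLp φ, hdom ▸ dense_univ, fun f hf =>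
    congrArg (modelSpace θ).orthogonalProjectionOnto (Lp.ext ?_)⟩
  exact (((ContinuousLinearMap.mul ℂ ℂ).coeFn_holder φ (f : L2Torus)).trans (hmul f)).trans
    hf.coeFn_toLp.symm

theorem IsTruncatedToeplitz.exists_inner_eq_integral {A : modelSpace θ →L[ℂ] modelSpace θ}
    (hA : IsTruncatedToeplitz θ A) (hθ : ∀ f ∈ modelSpace θ, MemLp f ⊤ torusMeasure) :
    ∃ φ : UnitTorus → ℂ, ∀ f g : modelSpace θ, ⟪f, A g⟫_ℂ =
      ∫ x, conj ((f : L2Torus) x) * (φ x * (g : L2Torus) x) ∂torusMeasure := by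
  obtain ⟨φ, -, hA⟩ := hA
  refine ⟨φ, fun f g => ?_⟩
  have hg : MemLp (fun x => φ x * (g : L2Torus) x) 2 torusMeasure :=
    (hθ g g.2).mul (Lp.memLp φ)
  rw [hA g hg, Submodule.inner_orthogonalProjectionOnto_eq_of_mem_left, inner_eq_integral_conj_mul]
  refine integral_congr_ae ?_
  filter_upwards [hg.coeFn_toLp] with x hx
  rw [hx]

theorem IsTruncatedToeplitz.isCSymmetric_compression {α : UnitTorus → ℂ} (hα : IsInner α)
    (h : InnerDivides α θ) {A : modelSpace θ →L[ℂ] modelSpace θ} (hA : IsTruncatedToeplitz θ A)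
    (hθ : ∀ f ∈ modelSpace θ, MemLp f ⊤ torusMeasure) :
    IsCSymmetric (modelConj α hα) (compression α θ hα h A) := by
  obtain ⟨φ, hφ⟩ := hA.exists_inner_eq_integral hθ
  have hle := modelSpace_le_of_innerDivides hα h
  exact isCSymmetric_modelConj_of_inner_eq_integral hα fun f g =>
    (inner_compression hα h A f g).trans (hφ ⟨f, hle f.2⟩ ⟨g, hle g.2⟩)

end TruncatedToeplitz

section AdjoinZero

variable {α : UnitTorus → ℂ}

/-- The inner function `α b_a`, with the extra zero `a`. -/
noncomputable def adjoinZero (α : UnitTorus → ℂ) (a : 𝔻) (x : UnitTorus) : ℂ :=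
  α x * blaschkeFactor a x

/-- The Takenaka–Malmquist function `α k_a`, which spans `K²_{α b_a} ⊖ K²_α`. -/
noncomputable def takenakaMalmquist (α : UnitTorus → ℂ) (a : 𝔻) (x : UnitTorus) : ℂ :=
  α x * szegoKernel a x

theorem isInner_adjoinZero (hα : IsInner α) (a : 𝔻) : IsInner (adjoinZero α a) :=
  hα.mul (isInner_blaschkeFactor a)

theorem memHardy_takenakaMalmquist (hα : IsInner α) (a : 𝔻) :
    MemHardy (takenakaMalmquist α a) ⊤ :=
  (hα.memHardy ⊤).mul le_top (memHardy_szegoKernel a ⊤ le_top)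

theorem conj_blaschkeFactor_mul_szegoKernel (a : 𝔻) :
    ∀ᵐ x ∂torusMeasure, conj (blaschkeFactor a x) * szegoKernel a x =
      conj ((toCircle x : ℂ) * szegoKernel a x) := by
  filter_upwards [(isInner_blaschkeFactor a).conj_mul_self] with x hx
  rw [← blaschkeFactor] at hx
  rw [← blaschkeFactor_mul_conj, ← mul_assoc, hx, one_mul, blaschkeFactor_mul_conj]

theorem integral_conj_adjoinZero_mul_takenakaMalmquist (hα : IsInner α) (a : 𝔻)
    {g : UnitTorus → ℂ} (hg : MemHardy g 2) :
    ∫ x, conj (adjoinZero α a x * g x) * takenakaMalmquist α a x ∂torusMeasure = 0 := by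
  have hkg : MemHardy (fun x => szegoKernel a x * g x) 2 :=
    (memHardy_szegoKernel a ⊤ le_top).mul le_rfl hg
  have h0 : fourierCoeff (fun x => (toCircle x : ℂ) * (szegoKernel a x * g x)) 0 = 0 := by
    rw [fourierCoeff_toCircle_mul, hkg.coeff_neg _ (by norm_num)]
  have hconj := congrArg conj h0
  rw [fourierCoeff_eq_integral_mul, ← integral_conj, map_zero] at hconj
  rw [← hconj]
  refine integral_congr_ae ?_
  filter_upwards [hα.conj_mul_self, conj_blaschkeFactor_mul_szegoKernel a] with x hαx hbx
  rw [neg_zero, fourier_zero, adjoinZero, takenakaMalmquist]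
  simp only [map_mul, map_one] at hbx ⊢
  linear_combination conj (blaschkeFactor a x) * szegoKernel a x * conj (g x) * hαx +
    conj (g x) * hbx

/-- The Takenaka–Malmquist function as a vector of `K²_{α b_a}`. -/
noncomputable def takenakaMalmquistVec (hα : IsInner α) (a : 𝔻) : modelSpace (adjoinZero α a) where
  val := ((memHardy_takenakaMalmquist hα a).memLp.mono_exponent le_top).toLp _
  property := by
    have he := (memHardy_takenakaMalmquist hα a).memLp.mono_exponent (p := 2) le_top
    refine (mem_modelSpace_iff (isInner_adjoinZero hα a) _).2
      ⟨MemHardy.toLp_mem_hardySpace ⟨he, (memHardy_takenakaMalmquist hα a).coeff_neg⟩,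
        fun g hg => ?_⟩
    rw [← integral_conj_adjoinZero_mul_takenakaMalmquist hα a (memHardy_coe_iff.2 hg)]
    refine integral_congr_ae ?_
    filter_upwards [he.coeFn_toLp] with x hx
    rw [hx]

theorem coeFn_takenakaMalmquistVec (hα : IsInner α) (a : 𝔻) :
    (takenakaMalmquistVec hα a : L2Torus) =ᵐ[torusMeasure] takenakaMalmquist α a :=
  ((memHardy_takenakaMalmquist hα a).memLp.mono_exponent le_top).coeFn_toLp

/-- The Takenaka–Malmquist function as a bounded symbol. -/
noncomputable def takenakaMalmquistSymbol (hα : IsInner α) (a : 𝔻) : Lp ℂ ⊤ torusMeasure :=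
  (memHardy_takenakaMalmquist hα a).memLp.toLp _

theorem modelConj_takenakaMalmquistVec (hα : IsInner α) (a : 𝔻) :
    (modelConj _ (isInner_adjoinZero hα a) (takenakaMalmquistVec hα a) : L2Torus)
      =ᵐ[torusMeasure] szegoKernel a := by
  filter_upwards [coeFn_modelConj (isInner_adjoinZero hα a) (takenakaMalmquistVec hα a),
    coeFn_takenakaMalmquistVec hα a, hα.conj_mul_self] with x hC he hαx
  have hbx := blaschkeFactor_mul_conj a x
  rw [hC, he, adjoinZero, takenakaMalmquist]
  simp only [map_mul] at hbx ⊢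
  linear_combination
    blaschkeFactor a x * conj (toCircle x : ℂ) * conj (szegoKernel a x) * hαx + hbx

theorem mem_modelSpace_of_inner_takenakaMalmquistVec_eq_zero (hα : IsInner α) {a : 𝔻}
    {f : modelSpace (adjoinZero α a)} (hf : ⟪takenakaMalmquistVec hα a, f⟫_ℂ = 0) :
    (f : L2Torus) ∈ modelSpace α := by
  refine (mem_modelSpace_iff hα _).2 ⟨f.2.1, fun g hg => ?_⟩
  obtain ⟨c, h, hh, hgh⟩ := (memHardy_coe_iff.2 hg).exists_eq_const_mul_szegoKernel_add a
  have hv := ((isInner_adjoinZero hα a).memLp_mul hh.memLp).coeFn_toLp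
  set v : L2Torus := MemLp.toLp _ ((isInner_adjoinZero hα a).memLp_mul hh.memLp)
  have hdecomp : (fun x => α x * g x) =ᵐ[torusMeasure]
      (c • (takenakaMalmquistVec hα a : L2Torus) + v : L2Torus) := by
    filter_upwards [Lp.coeFn_add (c • (takenakaMalmquistVec hα a : L2Torus)) v,
      Lp.coeFn_smul c (takenakaMalmquistVec hα a : L2Torus), coeFn_takenakaMalmquistVec hα a, hv]
      with x hadd hsmul he hvx
    rw [hadd, Pi.add_apply, hsmul, Pi.smul_apply, he, hvx, hgh, smul_eq_mul, takenakaMalmquist,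
      adjoinZero]
    ring
  have hinner : ⟪c • (takenakaMalmquistVec hα a : L2Torus) + v, (f : L2Torus)⟫_ℂ = 0 := by
    rw [inner_add_left, inner_smul_left, ← Submodule.coe_inner, hf, mul_zero, zero_add,
      inner_eq_zero_symm, inner_eq_zero_of_mem_modelSpace f.2 hh hv]
  rw [← hinner, inner_eq_integral_conj_mul]
  refine integral_congr_ae ?_
  filter_upwards [hdecomp] with x hx
  rw [hx]

theorem memLp_top_of_mem_modelSpace_adjoinZero (hα : IsInner α) (a : 𝔻)
    (hbdd : ∀ f ∈ modelSpace α, MemLp f ⊤ torusMeasure) :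
    ∀ f ∈ modelSpace (adjoinZero α a), MemLp f ⊤ torusMeasure := fun f hf => by
  have horth := inner_sub_inner_div_smul (takenakaMalmquistVec hα a) ⟨f, hf⟩
  set c : ℂ := ⟪takenakaMalmquistVec hα a, ⟨f, hf⟩⟫_ℂ /
    ⟪takenakaMalmquistVec hα a, takenakaMalmquistVec hα a⟫_ℂ
  have hsub := hbdd _ (mem_modelSpace_of_inner_takenakaMalmquistVec_eq_zero hα horth)
  refine (hsub.add ((memHardy_takenakaMalmquist hα a).memLp.const_mul c)).ae_eq ?_
  filter_upwards [Lp.coeFn_sub f (c • (takenakaMalmquistVec hα a : L2Torus)),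
    Lp.coeFn_smul c (takenakaMalmquistVec hα a : L2Torus), coeFn_takenakaMalmquistVec hα a]
    with x hsubx hsmul he
  rw [Pi.sub_apply, hsmul, Pi.smul_apply, he, smul_eq_mul] at hsubx
  exact (congrArg (· + c * takenakaMalmquist α a x) hsubx).trans (sub_add_cancel _ _)

open InnerProductSpace (rankOne)

theorem truncatedToeplitz_takenakaMalmquistSymbol (hα : IsInner α) (a : 𝔻) :
    truncatedToeplitz (adjoinZero α a) (takenakaMalmquistSymbol hα a) =
      rankOne ℂ (takenakaMalmquistVec hα a)
        (modelConj _ (isInner_adjoinZero hα a) (takenakaMalmquistVec hα a)) := by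
  refine ContinuousLinearMap.ext fun g => ext_inner_left ℂ fun f => ?_
  have hg : MemHardy (g : L2Torus) 2 := memHardy_coe_iff.2 g.2.1
  have hh := memHardy_dividedDifference a hg
  have hv := ((isInner_adjoinZero hα a).memLp_mul hh.memLp).coeFn_toLp
  set v : L2Torus := MemLp.toLp _ ((isInner_adjoinZero hα a).memLp_mul hh.memLp)
  have heval : ⟪modelConj _ (isInner_adjoinZero hα a) (takenakaMalmquistVec hα a), g⟫_ℂ =
      diskEval a (g : L2Torus) := by
    rw [Submodule.coe_inner, inner_eq_integral_conj_mul, diskEval]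
    refine integral_congr_ae ?_
    filter_upwards [modelConj_takenakaMalmquistVec hα a] with x hx
    rw [hx]
  rw [inner_truncatedToeplitz
      (u := diskEval a (g : L2Torus) • (takenakaMalmquistVec hα a : L2Torus) + v),
    inner_add_right, inner_eq_zero_of_mem_modelSpace f.2 hh hv, add_zero,
    InnerProductSpace.rankOne_apply, heval, inner_smul_right, inner_smul_right, Submodule.coe_inner]
  filter_upwards [Lp.coeFn_add (diskEval a (g : L2Torus) • (takenakaMalmquistVec hα a : L2Torus)) v,
    Lp.coeFn_smul (diskEval a (g : L2Torus)) (takenakaMalmquistVec hα a : L2Torus), hv,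
    coeFn_takenakaMalmquistVec hα a, (memHardy_takenakaMalmquist hα a).memLp.coeFn_toLp]
    with x hadd hsmul hvx he hE
  rw [hadd, Pi.add_apply, hsmul, Pi.smul_apply, he, hvx, takenakaMalmquistSymbol, hE, smul_eq_mul,
    takenakaMalmquist, adjoinZero]
  linear_combination -α x * szegoKernel_mul_eq_add a (g : L2Torus) x

theorem exists_inner_modelConj_takenakaMalmquistVec_ne_zero_or (hα : IsInner α) (a : 𝔻) :
    (∃ f, ⟪takenakaMalmquistVec hα a, f⟫_ℂ = 0 ∧
      ⟪modelConj _ (isInner_adjoinZero hα a) (takenakaMalmquistVec hα a), f⟫_ℂ ≠ 0) ∨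
    ∀ f, ⟪takenakaMalmquistVec hα a, f⟫_ℂ = 0 → f = 0 := by
  refine or_iff_not_imp_left.2 fun hne f hf => ?_
  push Not at hne
  obtain ⟨c, hc⟩ := exists_eq_smul_of_forall_inner_eq_zero fun f hf =>
    inner_eq_zero_symm.1 (hne f hf)
  have hconst : ∀ᵐ x ∂torusMeasure, α x = c⁻¹ := by
    filter_upwards [modelConj_takenakaMalmquistVec hα a, coeFn_takenakaMalmquistVec hα a,
      Lp.coeFn_smul c (takenakaMalmquistVec hα a : L2Torus)] with x hC he hsmul
    rw [hc, Submodule.coe_smul, hsmul, Pi.smul_apply, he, smul_eq_mul, takenakaMalmquist] at hC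
    refine eq_inv_of_mul_eq_one_right ?_
    linear_combination (1 - conj (a : ℂ) * toCircle x) * hC + (1 - c * α x) * szegoKernel_mul a x
  have hf' := mem_modelSpace_of_inner_takenakaMalmquistVec_eq_zero hα hf
  rw [modelSpace_eq_bot_of_ae_eq_const hα hconst, Submodule.mem_bot] at hf'
  exact Subtype.ext hf'

theorem exists_eq_truncatedToeplitz_of_eq_adjoinZero {θ : UnitTorus → ℂ} {a : 𝔻} (hα : IsInner α)
    (hθ : IsInner θ) (hθα : θ = adjoinZero α a) {A : modelSpace θ →L[ℂ] modelSpace θ}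
    (hA : IsCSymmetric (modelConj θ hθ) A) (φ : Lp ℂ ⊤ torusMeasure)
    (hφ : ∀ f g : modelSpace θ, (f : L2Torus) ∈ modelSpace α → (g : L2Torus) ∈ modelSpace α →
      ⟪f, A g⟫_ℂ = ⟪f, truncatedToeplitz θ φ g⟫_ℂ) :
    ∃ ψ, A = truncatedToeplitz θ ψ := by
  subst hθα
  obtain ⟨s, t, hst⟩ := (isConjugation_modelConj hθ).exists_eq_smul_rankOne_add
    (e := takenakaMalmquistVec hα a) (hA.sub (isCSymmetric_truncatedToeplitz hθ φ))
    (fun f g hf hg => by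
      rw [sub_apply, inner_sub_right, sub_eq_zero]
      exact hφ f g (mem_modelSpace_of_inner_takenakaMalmquistVec_eq_zero hα hf)
        (mem_modelSpace_of_inner_takenakaMalmquistVec_eq_zero hα hg))
    (exists_inner_modelConj_takenakaMalmquistVec_ne_zero_or hα a)
  refine ⟨φ + (s • takenakaMalmquistSymbol hα a + t • star (takenakaMalmquistSymbol hα a)), ?_⟩
  rw [truncatedToeplitz_add, truncatedToeplitz_add, truncatedToeplitz_smul, truncatedToeplitz_smul,
    truncatedToeplitz_star, truncatedToeplitz_takenakaMalmquistSymbol,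
    InnerProductSpace.adjoint_rankOne, ← hst, add_sub_cancel]

end AdjoinZero

section Blaschke

variable {N : ℕ}

theorem onTorus_blaschke_succ (c : Circle) (a : Fin (N + 1) → 𝔻) :
    onTorus (blaschke c a) =
      adjoinZero (onTorus (blaschke c fun j => a j.castSucc)) (a (Fin.last N)) := by
  ext x
  rw [adjoinZero, onTorus, onTorus, blaschke, blaschke, blaschkeFactor, Fin.prod_univ_castSucc,
    mul_assoc]

theorem modelSpace_blaschke_zero (c : Circle) (a : Fin 0 → 𝔻) :
    modelSpace (onTorus (blaschke c a)) = ⊥ :=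
  modelSpace_eq_bot_of_ae_eq_const (isInner_blaschke c a) (c := c)
    (.of_forall fun x => by rw [onTorus, blaschke, Fin.prod_univ_zero, mul_one])

theorem memLp_top_of_mem_modelSpace_blaschke (c : Circle) (a : Fin N → 𝔻) :
    ∀ f ∈ modelSpace (onTorus (blaschke c a)), MemLp f ⊤ torusMeasure := by
  induction N with
  | zero =>
    intro f hf
    rw [modelSpace_blaschke_zero, Submodule.mem_bot] at hf
    rw [hf]
    exact MemLp.zero.ae_eq (Lp.coeFn_zero ℂ 2 torusMeasure).symm
  | succ N ih =>
    rw [onTorus_blaschke_succ]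
    exact memLp_top_of_mem_modelSpace_adjoinZero (isInner_blaschke c _) _ (ih _)

theorem modelSpace_blaschke_le (c d : Circle) (a : Fin N → 𝔻) :
    modelSpace (onTorus (blaschke c a)) ≤ modelSpace (onTorus (blaschke d a)) :=
  modelSpace_le_of_eq_const_mul (c := d / c) fun x => by
    rw [onTorus, onTorus, blaschke, blaschke, ← mul_assoc, div_mul_cancel₀ _ c.coe_ne_zero]

theorem exists_compression_blaschke_eq_truncatedToeplitz (c : Circle) (a : Fin N → 𝔻)
    (A : modelSpace (onTorus (blaschke c a)) →L[ℂ] modelSpace (onTorus (blaschke c a)))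
    (hA : ∀ (n : ℕ) (_ : 1 ≤ n) (hn : n ≤ N),
      IsCSymmetric (modelConj _ (isInner_blaschke 1 (initialZeros a hn)))
        (compression _ _ (isInner_blaschke 1 (initialZeros a hn))
          (innerDivides_blaschke_initialZeros c a hn) A)) (n : ℕ) (hn : n ≤ N) :
    ∃ φ, compression _ _ (isInner_blaschke 1 (initialZeros a hn))
      (innerDivides_blaschke_initialZeros c a hn) A = truncatedToeplitz _ φ := by
  induction n with
  | zero =>
    refine ⟨0, ContinuousLinearMap.ext fun f => ?_⟩
    have hf : f = 0 := Subtype.ext ((modelSpace_blaschke_zero 1 _).le f.2)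
    rw [hf, map_zero, map_zero]
  | succ n ih =>
    obtain ⟨φ, hφ⟩ := ih (Nat.le_of_succ_le hn)
    refine exists_eq_truncatedToeplitz_of_eq_adjoinZero (isInner_blaschke 1 _)
      (isInner_blaschke 1 _) (onTorus_blaschke_succ 1 (initialZeros a hn))
      (hA (n + 1) n.succ_pos hn) φ fun f g hf hg => ?_
    have h := inner_compression (isInner_blaschke 1 (initialZeros a (Nat.le_of_succ_le hn)))
      (innerDivides_blaschke_initialZeros c a _) A ⟨f, hf⟩ ⟨g, hg⟩
    rw [hφ, inner_truncatedToeplitz_eq_integral] at h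
    rw [inner_compression, inner_truncatedToeplitz_eq_integral, h]

theorem isTruncatedToeplitz_of_isCSymmetric_compression_initialZeros (c : Circle) (a : Fin N → 𝔻)
    {A : modelSpace (onTorus (blaschke c a)) →L[ℂ] modelSpace (onTorus (blaschke c a))}
    (hA : ∀ (n : ℕ) (_ : 1 ≤ n) (hn : n ≤ N),
      IsCSymmetric (modelConj _ (isInner_blaschke 1 (initialZeros a hn)))
        (compression _ _ (isInner_blaschke 1 (initialZeros a hn))
          (innerDivides_blaschke_initialZeros c a hn) A)) :
    IsTruncatedToeplitz (onTorus (blaschke c a)) A := by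
  obtain ⟨φ, hφ⟩ := exists_compression_blaschke_eq_truncatedToeplitz c a A hA N le_rfl
  suffices h : A = truncatedToeplitz _ φ from h ▸ isTruncatedToeplitz_truncatedToeplitz φ
  refine ContinuousLinearMap.ext fun g => ext_inner_left ℂ fun f => ?_
  have hle := modelSpace_blaschke_le c 1 a
  have h := inner_compression (isInner_blaschke 1 (initialZeros a le_rfl))
    (innerDivides_blaschke_initialZeros c a _) A ⟨f, hle f.2⟩ ⟨g, hle g.2⟩
  rw [hφ, inner_truncatedToeplitz_eq_integral] at h
  rw [inner_truncatedToeplitz_eq_integral, h, Submodule.coe_inner]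

end Blaschke

theorem theorem4p3_general {N : ℕ} (a : Fin N → Complex.UnitDisc) (c : Circle)
    (A : modelSpace (onTorus (blaschke c a)) →L[ℂ] modelSpace (onTorus (blaschke c a))) :
    List.TFAE [
      IsTruncatedToeplitz (onTorus (blaschke c a)) A,
      ∀ (m : ℕ) (_ : 1 ≤ m) (d : Circle) (b : Fin m → Complex.UnitDisc)
        (h : InnerDivides (onTorus (blaschke d b)) (onTorus (blaschke c a))),
        IsCSymmetric (modelConj (onTorus (blaschke d b)) (isInner_blaschke d b))
          (compression (onTorus (blaschke d b)) (onTorus (blaschke c a)) (isInner_blaschke d b) h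
            A),
      ∀ (n : ℕ) (_ : 1 ≤ n) (hn : n ≤ N),
        IsCSymmetric
          (modelConj (onTorus (blaschke 1 (initialZeros a hn)))
            (isInner_blaschke 1 (initialZeros a hn)))
          (compression (onTorus (blaschke 1 (initialZeros a hn))) (onTorus (blaschke c a))
            (isInner_blaschke 1 (initialZeros a hn))
            (innerDivides_blaschke_initialZeros c a hn) A)] := by
  tfae_have 1 → 2 := fun hA _ _ d b h =>
    hA.isCSymmetric_compression (isInner_blaschke d b) h (memLp_top_of_mem_modelSpace_blaschke c a)
  tfae_have 2 → 3 := fun hA n hn1 hn =>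
    hA n hn1 1 (initialZeros a hn) (innerDivides_blaschke_initialZeros c a hn)
  tfae_have 3 → 1 := isTruncatedToeplitz_of_isCSymmetric_compression_initialZeros c a
  tfae_finish

theorem theorem4p3 {N : ℕ} (a : Fin N → Complex.UnitDisc) (ha : Function.Injective a) (c : Circle)
    (A : modelSpace (onTorus (blaschke c a)) →L[ℂ] modelSpace (onTorus (blaschke c a))) :
    List.TFAE [
      IsTruncatedToeplitz (onTorus (blaschke c a)) A,
      ∀ (m : ℕ) (_ : 1 ≤ m) (d : Circle) (b : Fin m → Complex.UnitDisc)
        (h : InnerDivides (onTorus (blaschke d b)) (onTorus (blaschke c a))),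
        IsCSymmetric (modelConj (onTorus (blaschke d b)) (isInner_blaschke d b))
          (compression (onTorus (blaschke d b)) (onTorus (blaschke c a)) (isInner_blaschke d b) h A),
      ∀ (n : ℕ) (_ : 1 ≤ n) (hn : n ≤ N),
        IsCSymmetric
          (modelConj (onTorus (blaschke 1 (initialZeros a hn)))
            (isInner_blaschke 1 (initialZeros a hn)))
          (compression (onTorus (blaschke 1 (initialZeros a hn))) (onTorus (blaschke c a))
            (isInner_blaschke 1 (initialZeros a hn))
            (innerDivides_blaschke_initialZeros c a hn) A)] :=
  theorem4p3_general a c A
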